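/- Let $d,n,m$ be integers with $d\ge 2$ and $n,m\ge 0$, and let $p_1,p_2\in[0,1]$. Let $\mathcal M_d$ denote the complex $d\times d$ matrices, $\vartheta_d:\mathcal M_d\to\mathcal M_d$ the transposition $X\mapsto X^T$, and let $P_{\mathrm{sym}}$, $P_{\mathrm{asym}}$ be the orthogonal projectors onto the symmetric and antisymmetric subspaces of $\mathbb C^d\otimes\mathbb C^d$. For $p\in[0,1]$ the Werner map $W_p:\mathcal M_d\to\mathcal M_d$ is the linear map whose Choi matrix $\sum_{i,j=1}^d |i\rangle\langle j|\otimes W_p(|i\rangle\langle j|)$ equals the Werner state $$\rho_W(p)=p\,\frac{P_{\mathrm{sym}}}{d(d+1)/2}+(1-p)\,\frac{P_{\mathrm{asym}}}{d(d-1)/2}.$$ A linear map $L$ between full matrix algebras is called decomposable if $L=T_1+\vartheta\circ T_2$ with $T_1,T_2$ completely positive and $\vartheta$ the transposition on the target algebra. For $N\ge 0$ let $V^N_d$ be the real $(N+1)\times(N+1)$ matrix with entries $$(V^N_d)_{ab}=(-1)^{a-1}\sum_{t=\max(0,a+b-N-2)}^{\min(a-1,b-1)}\binom{a-1}{t}\binom{N-a+1}{b-t-1}\left(-\frac{d+1}{d-1}\right)^t,\qquad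 a,b\in\{1,\dots,N+1\},$$ and for $p\in[0,1]$ let $|v^N_p\rangle\in\mathbb R^{N+1}$ be the vector with entries $$(|v^N_p\rangle)_k=\left(\frac{d+1}{d-1}\right)^{k-1}(1-p)^{k-1}p^{N-k+1},\qquad k\in\{1,\dots,N+1\}$$ (with $0^0=1$). Consider the linear program $$\begin{aligned}\text{minimize}\quad&\langle v^n_{p_1}|Q|v^m_{p_2}\rangle\\ \text{subject to}\quad& Q\in\mathbb R^{(n+1)\times(m+1)},\\ &(QV^m_d)_{ij}\ge 0,\quad (Q^TV^n_d)_{ji}\ge 0\quad\text{for all } i\in\{1,\dots,n+1\},\ j\in\{1,\dots,m+1\},\\ &\sum_{k=1}^{n+1}\sum_{l=1}^{m+1}Q_{kl}=1.\end{aligned}$$ Then the minimum of this linear program exists, and the mixed tensor power $W_{p_1}^{\otimes n}\otimes(\vartheta_d\circ W_{p_2})^{\otimes m}:\mathcal M_d^{\otimes(n+m)}\to\mathcal M_d^{\otimes(n+m)}$ is decomposable if and only if this minimum is $\ge 0$. -/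

import Mathlib

open scoped Matrix ComplexOrder

noncomputable section

namespace WernerLP

/-- Linear maps `M_a → M_b` between full complex matrix algebras, the bases being indexed by
the finite types `a` and `b`. -/
abbrev MatMap (a b : Type) : Type := Matrix a a ℂ →ₗ[ℂ] Matrix b b ℂ

/-- `(id_κ ⊗ L)(X)` for `X ∈ M_κ ⊗ M_a`: apply `L` to every block of `X`. -/
def ampliation {a b : Type} (κ : Type) (L : MatMap a b) (X : Matrix (κ × a) (κ × a) ℂ) :
    Matrix (κ × b) (κ × b) ℂ :=
  Matrix.of fun x y => L (Matrix.of fun r s => X (x.1, r) (y.1, s)) x.2 y.2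

/-- Complete positivity: `id_k ⊗ L` preserves positive semidefiniteness for every `k`. -/
def IsCompletelyPositive {a b : Type} (L : MatMap a b) : Prop :=
  ∀ (k : ℕ) (X : Matrix (Fin k × a) (Fin k × a) ℂ),
    X.PosSemidef → (ampliation (Fin k) L X).PosSemidef

/-- The transposition map `ϑ` on `M_a`. -/
def transposition (a : Type) : MatMap a a :=
  (Matrix.transposeLinearEquiv a a ℂ ℂ).toLinearMap

/-- `L` is decomposable if `L = T₁ + ϑ ∘ T₂` with `T₁, T₂` completely positive. -/
def IsDecomposable {a b : Type} (L : MatMap a b) : Prop :=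
  ∃ T₁ T₂ : MatMap a b, IsCompletelyPositive T₁ ∧ IsCompletelyPositive T₂ ∧
    L = T₁ + (transposition b).comp T₂

/-- The unnormalized maximally entangled state `ω = |Ω⟩⟨Ω|`, `|Ω⟩ = ∑ i, |i⟩ ⊗ |i⟩`. -/
def omega (a : Type) [DecidableEq a] : Matrix (a × a) (a × a) ℂ :=
  Matrix.vecMulVec (fun x => if x.1 = x.2 then 1 else 0) (fun y => if y.1 = y.2 then 1 else 0)

/-- The Choi matrix `C_L = (id ⊗ L)(ω)`. -/
def choi {a b : Type} [DecidableEq a] (L : MatMap a b) : Matrix (a × b) (a × b) ℂ :=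
  ampliation a L (omega a)

/-- The linear map with a prescribed Choi matrix (see `choi_ofChoi` and `ofChoi_choi`). -/
def ofChoi {a b : Type} [Fintype a] (C : Matrix (a × b) (a × b) ℂ) : MatMap a b where
  toFun X := Matrix.of fun r s => ∑ i, ∑ j, X i j * C (i, r) (j, s)
  map_add' X Y := by
    ext r s
    simp [add_mul, Finset.sum_add_distrib]
  map_smul' c X := by
    ext r s
    simp [mul_assoc, Finset.mul_sum]

theorem choi_apply {a b : Type} [DecidableEq a] (L : MatMap a b) (x y : a × b) :
    choi L x y = L (Matrix.single x.1 y.1 1) x.2 y.2 := by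
  have h : (Matrix.of fun r s => omega a (x.1, r) (y.1, s)) = Matrix.single x.1 y.1 (1 : ℂ) := by
    ext r s
    by_cases h1 : x.1 = r <;> by_cases h2 : y.1 = s <;>
      simp [omega, Matrix.vecMulVec_apply, h1, h2]
  simp [choi, ampliation, h]

theorem choi_ofChoi {a b : Type} [Fintype a] [DecidableEq a] (C : Matrix (a × b) (a × b) ℂ) :
    choi (ofChoi C) = C := by
  ext x y
  rw [choi_apply]
  simp only [ofChoi, LinearMap.coe_mk, AddHom.coe_mk, Matrix.of_apply, Matrix.single_apply]
  rw [Finset.sum_eq_single x.1 (by intro i _ hi; simp [hi.symm]) (by simp),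
    Finset.sum_eq_single y.1 (by intro j _ hj; simp [hj.symm]) (by simp)]
  simp

theorem ofChoi_choi {a b : Type} [Fintype a] [DecidableEq a] (L : MatMap a b) :
    ofChoi (choi L) = L := by
  refine LinearMap.ext fun X => ?_
  conv_rhs => rw [Matrix.matrix_eq_sum_single X]
  ext r s
  simp only [ofChoi, LinearMap.coe_mk, AddHom.coe_mk, Matrix.of_apply, choi_apply, map_sum,
    Matrix.sum_apply]
  refine Finset.sum_congr rfl fun i _ => Finset.sum_congr rfl fun j _ => ?_
  have : Matrix.single i j (X i j) = X i j • Matrix.single i j (1 : ℂ) := by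
    simp [Matrix.smul_single]
  rw [this, map_smul]
  simp

/-- The flip operator `𝔽 (|i⟩ ⊗ |j⟩) = |j⟩ ⊗ |i⟩` on `ℂ^d ⊗ ℂ^d`. -/
def flip (d : ℕ) : Matrix (Fin d × Fin d) (Fin d × Fin d) ℂ :=
  Matrix.of fun x y => if x = y.swap then 1 else 0

/-- The projector onto the symmetric subspace. -/
def Psym (d : ℕ) : Matrix (Fin d × Fin d) (Fin d × Fin d) ℂ := (1 / 2 : ℂ) • (1 + flip d)

/-- The projector onto the antisymmetric subspace. -/
def Pasym (d : ℕ) : Matrix (Fin d × Fin d) (Fin d × Fin d) ℂ := (1 / 2 : ℂ) • (1 - flip d)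

/-- The Werner state `ρ_W(p) = p P_sym / tr P_sym + (1 - p) P_asym / tr P_asym`. -/
def wernerState (d : ℕ) (p : ℝ) : Matrix (Fin d × Fin d) (Fin d × Fin d) ℂ :=
  ((p : ℂ) / (Psym d).trace) • Psym d + ((1 - (p : ℂ)) / (Pasym d).trace) • Pasym d

/-- The Werner map `W_p : M_d → M_d`, whose Choi matrix is the Werner state `ρ_W(p)`. -/
def wernerMap (d : ℕ) (p : ℝ) : MatMap (Fin d) (Fin d) := ofChoi (wernerState d p)

/-- The tensor product `⨂ i, X i` of square matrices; `M_a^{⊗ι}` is identified with the matrix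
algebra over the index set `ι → a`. -/
def tensorMatrix {ι a : Type} [Fintype ι] (X : ι → Matrix a a ℂ) :
    Matrix (ι → a) (ι → a) ℂ :=
  Matrix.of fun r s => ∏ k, X k (r k) (s k)

/-- The tensor product `⨂ i, L i : M_a^{⊗ι} → M_b^{⊗ι}` of linear maps, written on matrix units
(see `tensorMap_tensorMatrix`). -/
def tensorMap {ι a b : Type} [Fintype ι] [DecidableEq ι] [Fintype a] [DecidableEq a]
    (L : ι → MatMap a b) : MatMap (ι → a) (ι → b) where
  toFun X := ∑ i, ∑ j, X i j • tensorMatrix fun k => L k (Matrix.single (i k) (j k) 1)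
  map_add' X Y := by simp [add_smul, Finset.sum_add_distrib]
  map_smul' c X := by simp [mul_smul, Finset.smul_sum]

/-- `(⨂ i, L i)(⨂ i, X i) = ⨂ i, L i (X i)`. -/
theorem tensorMap_tensorMatrix {ι a b : Type} [Fintype ι] [DecidableEq ι] [Fintype a]
    [DecidableEq a] (L : ι → MatMap a b) (X : ι → Matrix a a ℂ) :
    tensorMap L (tensorMatrix X) = tensorMatrix fun k => L k (X k) := by
  ext r s
  have h : ∀ k, L k (X k) (r k) (s k)
      = ∑ i, ∑ j, X k i j * L k (Matrix.single i j 1) (r k) (s k) := fun k => by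
    conv_lhs => rw [← ofChoi_choi (L k)]
    simp [ofChoi, choi_apply]
  simp only [tensorMap, tensorMatrix, LinearMap.coe_mk, AddHom.coe_mk, Matrix.sum_apply,
    Matrix.smul_apply, Matrix.of_apply, smul_eq_mul, h]
  rw [Finset.prod_univ_sum]
  simp only [Fintype.piFinset_univ]
  refine Finset.sum_congr rfl fun i _ => ?_
  rw [Finset.prod_univ_sum]
  simp only [Fintype.piFinset_univ]
  refine Finset.sum_congr rfl fun j _ => ?_
  rw [Finset.prod_mul_distrib]

/-- The mixed tensor power `W_{p₁}^{⊗n} ⊗ (ϑ_d ∘ W_{p₂})^{⊗m}` on `M_d^{⊗(n+m)}`, the tensor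
factors being indexed by `Fin n ⊕ Fin m`. -/
def mixedPower (d n m : ℕ) (p₁ p₂ : ℝ) :
    MatMap (Fin n ⊕ Fin m → Fin d) (Fin n ⊕ Fin m → Fin d) :=
  tensorMap (Sum.elim (fun _ => wernerMap d p₁)
    (fun _ => (transposition (Fin d)).comp (wernerMap d p₂)))

/-- The matrix `V^m_d`, with rows and columns indexed from `0`; the truncated subtraction in the
lower summation bound is `max (0, a + b - m)`. -/
def V (d m : ℕ) : Matrix (Fin (m + 1)) (Fin (m + 1)) ℝ :=
  Matrix.of fun a b => (-1) ^ (a : ℕ) *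
    ∑ t ∈ Finset.Icc ((a : ℕ) + (b : ℕ) - m) (min (a : ℕ) (b : ℕ)),
      ((a : ℕ).choose t : ℝ) * ((m - (a : ℕ)).choose ((b : ℕ) - t) : ℝ) *
        (-(((d : ℝ) + 1) / ((d : ℝ) - 1))) ^ t

/-- The vector `v^n_p`, with entries indexed from `0`. -/
def v (d n : ℕ) (p : ℝ) : Fin (n + 1) → ℝ :=
  fun k => (((d : ℝ) + 1) / ((d : ℝ) - 1)) ^ (k : ℕ) * (1 - p) ^ (k : ℕ) * p ^ (n - (k : ℕ))

/-- The feasible set of the linear program. -/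
def feasible (d n m : ℕ) : Set (Matrix (Fin (n + 1)) (Fin (m + 1)) ℝ) :=
  {Q | (∀ i j, 0 ≤ (Q * V d m) i j) ∧ (∀ j i, 0 ≤ (Qᵀ * V d n) j i) ∧ ∑ k, ∑ l, Q k l = 1}

/-- The objective function `⟨v^n_{p₁}| Q |v^m_{p₂}⟩` of the linear program. -/
def objective (d n m : ℕ) (p₁ p₂ : ℝ) (Q : Matrix (Fin (n + 1)) (Fin (m + 1)) ℝ) : ℝ :=
  v d n p₁ ⬝ᵥ (Q *ᵥ v d m p₂)

end WernerLP

end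

open scoped Matrix ComplexOrder

noncomputable section

namespace WernerLP

/-! By Choi's theorem the map is decomposable exactly when its Choi matrix is `A + B^Γ` with `A`,
`B` positive semidefinite and `Γ` the partial transpose. The linear program is the dual problem,
restricted to site-permutation-invariant witnesses built from Werner projectors.

The Choi matrix is a combination of products with `P_sym`, `P_asym` on the first `n` sites and their
partial transposes on the last `m`; `Γ` exchanges the two roles. At one site the partial transposes
span the same space as `1` and `ω`, where the extreme positive elements are the multiples of `ω` and
`d - ω`. The change of basis is the 2×2 matrix `siteCoeff`, and `V` is its tensor power with strings
collected by weight (`sum_stringCoeff_wt`, `sum_mul_stringCoeff`).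

If the map is decomposable, each feasible `Q` gives a `witness` that is positive and has positive
partial transpose, because `Q V` and `Qᵀ V` are, up to positive factors, its coefficients in
positive products. Its trace against the Choi matrix is a positive multiple of the objective, and
against `A + B^Γ` it is nonnegative. Conversely, a nonnegative minimum yields nonnegative
multipliers by Farkas' lemma (`exists_dual_solution`), which are the coefficients of explicit `A`
and `B`; no twirling is needed. The minimum exists because the feasible set is compact
(`isCompact_feasible`). -/

/-! ### Boolean strings and their weights -/

/-- The number of `true`s in a Boolean string. -/
def wt {m : ℕ} (τ : Fin m → Bool) : Fin (m + 1) :=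
  ⟨∑ k, (τ k).toNat, Nat.lt_succ_of_le <| by
    simpa using Finset.sum_le_card_nsmul Finset.univ (fun k => (τ k).toNat) 1
      fun k _ => Bool.toNat_le (τ k)⟩

theorem prod_comp_eq_pow_wt {R : Type*} [CommMonoid R] {m : ℕ} (g : Bool → R)
    (τ : Fin m → Bool) :
    ∏ k, g (τ k) = g false ^ (m - (wt τ : ℕ)) * g true ^ (wt τ : ℕ) := by
  have h : ∀ b : Bool, g b = g false ^ (1 - b.toNat) * g true ^ b.toNat := by
    intro b; cases b <;> simp
  have h1 : ∑ k, (1 - (τ k).toNat) = m - (wt τ : ℕ) := by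
    rw [Finset.sum_tsub_distrib _ fun k _ => Bool.toNat_le (τ k)]
    simp [wt]
  rw [Finset.prod_congr rfl fun k _ => h (τ k), Finset.prod_mul_distrib,
    Finset.prod_pow_eq_pow_sum, Finset.prod_pow_eq_pow_sum, h1]
  rfl

open Polynomial in
-- Generating function: expand the product over sites, with `X` marking each `true`.
theorem sum_wt_eq_coeff {m : ℕ} (w : Fin m → Bool → ℝ) (j : ℕ) :
    ∑ τ : Fin m → Bool, (if (wt τ : ℕ) = j then ∏ k, w k (τ k) else 0)
      = (∏ k, (C (w k false) + C (w k true) * X) : ℝ[X]).coeff j := by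
  have h : ∀ k, (C (w k false) + C (w k true) * X : ℝ[X])
      = ∑ b : Bool, C (w k b) * X ^ b.toNat := by
    intro k; simp [add_comm]
  simp_rw [h]
  rw [Finset.prod_univ_sum, Fintype.piFinset_univ, finsetSum_coeff]
  refine Finset.sum_congr rfl fun τ _ => ?_
  rw [Finset.prod_mul_distrib, Finset.prod_pow_eq_pow_sum, ← map_prod, coeff_C_mul, coeff_X_pow]
  simp [wt, eq_comm]

theorem card_wt {m : ℕ} (j : Fin (m + 1)) :
    (∑ τ : Fin m → Bool, (if wt τ = j then 1 else 0) : ℝ) = m.choose j := by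
  have := sum_wt_eq_coeff (m := m) (fun _ _ => 1) j
  simp only [map_one, one_mul, Finset.prod_const_one, Finset.prod_const, Finset.card_univ,
    Fintype.card_fin, Polynomial.coeff_one_add_X_pow] at this
  simpa only [Fin.ext_iff] using this

/-- A sum over strings of a function of the weight. -/
theorem sum_comp_wt {m : ℕ} (f : Fin (m + 1) → ℝ) :
    ∑ τ : Fin m → Bool, f (wt τ) = ∑ j : Fin (m + 1), (m.choose j : ℝ) * f j := by
  have : ∀ τ : Fin m → Bool, f (wt τ) = ∑ j : Fin (m + 1), (if wt τ = j then 1 else 0) * f j := by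
    intro τ; simp
  simp_rw [this]
  rw [Finset.sum_comm]
  refine Finset.sum_congr rfl fun j _ => ?_
  rw [← card_wt, Finset.sum_mul]

theorem exists_wt_eq {m : ℕ} (j : Fin (m + 1)) : ∃ τ : Fin m → Bool, wt τ = j := by
  by_contra! h
  have h1 := card_wt j
  simp only [h, if_false, Finset.sum_const_zero] at h1
  exact (Nat.choose_pos (Nat.le_of_lt_succ j.2)).ne (by exact_mod_cast h1)

/-! ### The one-site change of basis and its tensor power `V` -/

/-- The ratio `(d + 1) / (d - 1)`. -/
def ratio (d : ℕ) : ℝ := ((d : ℝ) + 1) / ((d : ℝ) - 1)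

/-- The coefficients of `ω` (`false`) and `(d - ω) / (d - 1)` (`true`) in the basis of partial
transposes of `P_sym` (`false`) and `P_asym` (`true`). -/
def siteCoeff (d : ℕ) : Bool → Bool → ℝ
  | false, _ => 1
  | true, false => -1
  | true, true => ratio d

/-- The inverse of `siteCoeff`. -/
def siteCoeffInv (d : ℕ) : Bool → Bool → ℝ
  | false, false => ratio d / (ratio d + 1)
  | false, true => -1 / (ratio d + 1)
  | true, _ => 1 / (ratio d + 1)

/-- The tensor power of `siteCoeff`. -/
def stringCoeff (d : ℕ) {m : ℕ} (t τ : Fin m → Bool) : ℝ := ∏ k, siteCoeff d (t k) (τ k)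

theorem ratio_pos {d : ℕ} (hd : 2 ≤ d) : 0 < ratio d := by
  have : (2 : ℝ) ≤ d := by exact_mod_cast hd
  unfold ratio
  apply div_pos <;> linarith

theorem sum_siteCoeff_mul_inv {d : ℕ} (hd : 2 ≤ d) (a b : Bool) :
    ∑ c, siteCoeff d a c * siteCoeffInv d c b = if a = b then 1 else 0 := by
  have := ratio_pos hd
  have h : ratio d + 1 ≠ 0 := by positivity
  cases a <;> cases b <;> simp [siteCoeff, siteCoeffInv] <;> field_simp <;> ring

/-- For a string of weight `a` the generating function is `(1 + X)^(m-a) * (-1 + ratio d * X)^a`,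
and the double binomial sum defining `V` is its coefficient. -/
theorem sum_stringCoeff_wt (d : ℕ) {m : ℕ} (t : Fin m → Bool) (j : Fin (m + 1)) :
    ∑ τ, (if wt τ = j then stringCoeff d t τ else 0) = V d m (wt t) j := by
  have h := sum_wt_eq_coeff (fun k => siteCoeff d (t k)) j
  simp only [← Fin.ext_iff] at h
  unfold stringCoeff
  rw [h, prod_comp_eq_pow_wt
    (fun b => (Polynomial.C (siteCoeff d b false) + Polynomial.C (siteCoeff d b true) *
      Polynomial.X))]
  generalize wt t = a
  have hc : ∀ (a : ℕ) (c : ℝ) (k : ℕ), ((1 + Polynomial.C c * Polynomial.X) ^ a).coeff k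
      = (a.choose k : ℝ) * c ^ k := by
    intro a c k
    have : (1 + Polynomial.C c * Polynomial.X) ^ a
        = ((1 + Polynomial.X) ^ a : Polynomial ℝ).comp (Polynomial.C c * Polynomial.X) := by
      simp
    rw [this, Polynomial.comp_C_mul_X_coeff, Polynomial.coeff_one_add_X_pow]
  have h1 : (Polynomial.C (siteCoeff d true false) + Polynomial.C (siteCoeff d true true) *
      Polynomial.X) ^ (a : ℕ)
      = Polynomial.C ((-1) ^ (a : ℕ)) *
        (1 + Polynomial.C (-(ratio d)) * Polynomial.X) ^ (a : ℕ) := by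
    rw [map_pow, ← mul_pow]
    congr 1
    simp only [siteCoeff, map_neg, map_one]
    ring
  have h2 : (Polynomial.C (siteCoeff d false false) + Polynomial.C (siteCoeff d false true) *
      Polynomial.X) ^ (m - (a : ℕ))
      = (1 + Polynomial.C 1 * Polynomial.X) ^ (m - (a : ℕ)) := by
    simp [siteCoeff]
  rw [h1, h2, mul_comm, mul_assoc, Polynomial.coeff_C_mul, Polynomial.coeff_mul,
    Finset.Nat.sum_antidiagonal_eq_sum_range_succ_mk]
  simp only [hc, one_pow, mul_one, V, Matrix.of_apply]
  congr 1
  symm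
  -- The bounds in `V` only discard terms in which a binomial coefficient vanishes.
  refine Finset.sum_subset_zero_on_sdiff ?_ ?_ ?_
  · intro x hx
    simp only [Finset.mem_Icc, le_min_iff] at hx
    simp; omega
  · intro x hx
    simp only [Finset.mem_sdiff, Finset.mem_range, Finset.mem_Icc, le_min_iff, not_and_or,
      not_le] at hx
    rcases hx with ⟨hx1, hx2⟩
    rcases hx2 with h | h | h
    · rw [Nat.choose_eq_zero_of_lt (n := m - (a : ℕ)) (by have := a.2; omega)]; simp
    · rw [Nat.choose_eq_zero_of_lt h]; simp
    · omega
  · intro x _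
    simp only [ratio]
    ring

/-- The action of `V` on a row vector, read off on strings. -/
theorem sum_mul_stringCoeff (d : ℕ) {m : ℕ} (q : Fin (m + 1) → ℝ) (τ : Fin m → Bool) :
    ∑ t, q (wt t) / (m.choose (wt t)) * stringCoeff d t τ
      = (q ᵥ* V d m) (wt τ) / (m.choose (wt τ)) := by
  -- The left side is invariant under permuting sites, so it can be averaged over the weight class
  -- of `τ`; the average is computed by `sum_stringCoeff_wt`.
  have hdep : ∀ τ τ' : Fin m → Bool, wt τ = wt τ' →
      ∑ t, q (wt t) / (m.choose (wt t)) * stringCoeff d t τ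
        = ∑ t, q (wt t) / (m.choose (wt t)) * stringCoeff d t τ' := by
    have key : ∀ τ : Fin m → Bool, ∑ t, q (wt t) / (m.choose (wt t)) * stringCoeff d t τ
        = ∑ j : Fin (m + 1), q j / (m.choose j) *
          ((∏ k, (Polynomial.C (siteCoeff d false (τ k)) +
            Polynomial.C (siteCoeff d true (τ k)) * Polynomial.X)).coeff j) := by
      intro τ
      simp_rw [← sum_wt_eq_coeff (fun k b => siteCoeff d b (τ k)), ← Fin.ext_iff, Finset.mul_sum]
      rw [Finset.sum_comm]
      simp [stringCoeff]
    intro τ τ' h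
    rw [key, key]
    simp_rw [prod_comp_eq_pow_wt (fun b => (Polynomial.C (siteCoeff d false b) +
      Polynomial.C (siteCoeff d true b) * Polynomial.X)), h]
  have hpos : (0 : ℝ) < m.choose (wt τ) := by
    exact_mod_cast Nat.choose_pos (Nat.le_of_lt_succ (wt τ).2)
  rw [eq_div_iff hpos.ne', mul_comm, ← card_wt, Finset.sum_mul]
  have : ∀ τ' : Fin m → Bool, (if wt τ' = wt τ then (1 : ℝ) else 0) *
      ∑ t, q (wt t) / (m.choose (wt t)) * stringCoeff d t τ
      = ∑ t, q (wt t) / (m.choose (wt t)) *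
        (if wt τ' = wt τ then stringCoeff d t τ' else 0) := by
    intro τ'
    split_ifs with h
    · rw [one_mul, hdep τ τ' h.symm]
    · simp
  simp_rw [this]
  rw [Finset.sum_comm]
  simp_rw [← Finset.mul_sum, sum_stringCoeff_wt]
  rw [sum_comp_wt (fun k => q k / (m.choose k) * V d m k (wt τ))]
  simp only [Matrix.vecMul, dotProduct]
  refine Finset.sum_congr rfl fun k _ => ?_
  have hk : (m.choose k : ℝ) ≠ 0 := by
    exact_mod_cast (Nat.choose_pos (Nat.le_of_lt_succ k.2)).ne'
  field_simp

/-- A row vector killed by `V` lifts to a function on strings killed by the tensor power of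
`siteCoeff`, which the tensor power of `siteCoeffInv` inverts. -/
theorem isUnit_V {d : ℕ} (hd : 2 ≤ d) (m : ℕ) : IsUnit (V d m) := by
  rw [← Matrix.vecMul_injective_iff_isUnit]
  refine (injective_iff_map_eq_zero (Matrix.vecMulLinear (V d m))).2 fun q hq => ?_
  have hq : q ᵥ* V d m = 0 := hq
  funext j
  obtain ⟨t', rfl⟩ := exists_wt_eq j
  have h : ∑ τ, (∑ t, q (wt t) / (m.choose (wt t)) * stringCoeff d t τ) *
      ∏ k, siteCoeffInv d (τ k) (t' k) = 0 := by
    simp [sum_mul_stringCoeff, hq]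
  have h2 : ∀ t : Fin m → Bool, ∑ τ : Fin m → Bool, stringCoeff d t τ *
      ∏ k, siteCoeffInv d (τ k) (t' k) = if t = t' then 1 else 0 := by
    intro t
    simp_rw [stringCoeff, ← Finset.prod_mul_distrib]
    have := (Finset.prod_univ_sum (fun _ : Fin m => (Finset.univ : Finset Bool))
      (fun k c => siteCoeff d (t k) c * siteCoeffInv d c (t' k)))
    rw [Fintype.piFinset_univ] at this
    rw [← this]
    simp only [sum_siteCoeff_mul_inv hd, Finset.prod_ite_zero, Finset.mem_univ, true_imp_iff,
      Finset.prod_const_one, funext_iff]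
  simp_rw [Finset.sum_mul, mul_assoc] at h
  rw [Finset.sum_comm] at h
  simp_rw [← Finset.mul_sum, h2] at h
  simp only [mul_ite, mul_one, mul_zero, Finset.sum_ite_eq', Finset.mem_univ, if_true] at h
  have hk : (m.choose (wt t') : ℝ) ≠ 0 := by
    exact_mod_cast (Nat.choose_pos (Nat.le_of_lt_succ (wt t').2)).ne'
  simpa [hk] using h

/-- A positive vector that `V` maps to the all-ones vector. -/
theorem exists_pos_V_mulVec_eq_one {d : ℕ} (hd : 2 ≤ d) (m : ℕ) :
    ∃ c : Fin (m + 1) → ℝ, (∀ j, 0 < c j) ∧ V d m *ᵥ c = 1 := by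
  have hd' : (2 : ℝ) ≤ d := by exact_mod_cast hd
  -- These are the coefficients in `1 = (1/d) ω + ((d-1)/d) (d-ω)/(d-1)`, while `1` is also the sum
  -- of the two partially transposed projectors, with both coefficients one.
  set β : Bool → ℝ := fun b => cond b (((d : ℝ) - 1) / d) (1 / d) with hβ
  have hβ0 : ∀ b, 0 < β b := by
    intro b; cases b <;> simp only [hβ, cond_true, cond_false] <;> apply div_pos <;> linarith
  refine ⟨fun j => β false ^ (m - (j : ℕ)) * β true ^ (j : ℕ), fun j => ?_, ?_⟩
  · have := hβ0 false; have := hβ0 true; positivity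
  funext i
  obtain ⟨t, rfl⟩ := exists_wt_eq i
  simp only [Matrix.mulVec, dotProduct, ← sum_stringCoeff_wt, Finset.sum_mul, ite_mul, zero_mul,
    Pi.one_apply]
  rw [Finset.sum_comm]
  simp only [Finset.sum_ite_eq, Finset.mem_univ, if_true, ← prod_comp_eq_pow_wt β, stringCoeff,
    ← Finset.prod_mul_distrib]
  have := (Finset.prod_univ_sum (fun _ : Fin m => (Finset.univ : Finset Bool))
      (fun k c => siteCoeff d (t k) c * β c))
  rw [Fintype.piFinset_univ] at this
  rw [← this]
  refine Finset.prod_eq_one fun k _ => ?_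
  have h1 : (d : ℝ) ≠ 0 := by positivity
  have h2 : (d : ℝ) - 1 ≠ 0 := by linarith
  cases t k <;> simp [siteCoeff, hβ, ratio] <;> field_simp <;> ring

/-- A positive vector whose image under `Vᵀ` is positive. -/
theorem exists_pos_vecMul_V_pos {d : ℕ} (hd : 2 ≤ d) (m : ℕ) :
    ∃ a : Fin (m + 1) → ℝ, (∀ j, 0 < a j) ∧ ∀ j, 0 < (a ᵥ* V d m) j := by
  have hd' : (2 : ℝ) ≤ d := by exact_mod_cast hd
  have hr := ratio_pos hd
  have hc : ∀ k : Fin (m + 1), (0 : ℝ) < m.choose k := fun k => by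
    exact_mod_cast Nat.choose_pos (Nat.le_of_lt_succ k.2)
  -- With weights 2 and 1 the columns of `siteCoeff` give `2 - 1` and `2 + ratio d`, both positive;
  -- tensor powers keep this.
  set β : Bool → ℝ := fun b => cond b 1 2 with hβ
  refine ⟨fun j => m.choose j * (β false ^ (m - (j : ℕ)) * β true ^ (j : ℕ)), fun j => ?_,
    fun j => ?_⟩
  · have := hc j; simp only [hβ, cond_true, cond_false]; positivity
  obtain ⟨τ, rfl⟩ := exists_wt_eq j
  have h := sum_mul_stringCoeff d
    (fun j => m.choose j * (β false ^ (m - (j : ℕ)) * β true ^ (j : ℕ))) τ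
  have h3 : ∀ t : Fin m → Bool, (m.choose (wt t) : ℝ) *
      (β false ^ (m - (wt t : ℕ)) * β true ^ (wt t : ℕ)) / (m.choose (wt t))
      = ∏ k, β (t k) := by
    intro t
    rw [prod_comp_eq_pow_wt, mul_div_assoc, mul_comm, div_mul_cancel₀ _ (hc _).ne']
  simp only [h3, stringCoeff, ← Finset.prod_mul_distrib] at h
  have h4 := (Finset.prod_univ_sum (fun _ : Fin m => (Finset.univ : Finset Bool))
      (fun k c => β c * siteCoeff d c (τ k)))
  rw [Fintype.piFinset_univ] at h4
  rw [← h4] at h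
  have h5 : 0 < ∏ k, ∑ c, β c * siteCoeff d c (τ k) := by
    refine Finset.prod_pos fun k _ => ?_
    cases τ k <;> simp [siteCoeff, hβ] <;> linarith
  rw [h] at h5
  exact (div_pos_iff_of_pos_right (hc _)).1 h5

/-! ### Farkas' lemma -/

/-- **Farkas' lemma** for finitely many generators in an open half-space. -/
theorem exists_nonneg_sum_eq {ι κ : Type} [Fintype ι] [Nonempty ι] [Fintype κ] [DecidableEq κ]
    (g : ι → κ → ℝ) (q₀ : κ → ℝ) (h₀ : ∀ i, 0 < q₀ ⬝ᵥ g i) (y : κ → ℝ)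
    (hy : ∀ q : κ → ℝ, (∀ i, 0 ≤ q ⬝ᵥ g i) → 0 ≤ q ⬝ᵥ y) :
    ∃ a : ι → ℝ, (∀ i, 0 ≤ a i) ∧ y = ∑ i, a i • g i := by
  have hy0 : 0 ≤ q₀ ⬝ᵥ y := hy q₀ fun i => (h₀ i).le
  rcases hy0.eq_or_lt with h | h
  · refine ⟨0, fun _ => le_rfl, ?_⟩
    have hle : ∀ q : κ → ℝ, 0 ≤ q ⬝ᵥ y := by
      intro q
      -- Adding a large multiple of `q₀` makes any `q` nonnegative on the generators without
      -- changing its value on `y`; hence `y` pairs nonnegatively with every vector and is zero.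
      set M := ∑ i, |q ⬝ᵥ g i| / (q₀ ⬝ᵥ g i)
      have := hy (M • q₀ + q) fun i => by
        have h1 : |q ⬝ᵥ g i| / (q₀ ⬝ᵥ g i) ≤ M :=
          Finset.single_le_sum (f := fun i => |q ⬝ᵥ g i| / (q₀ ⬝ᵥ g i))
            (fun i _ => div_nonneg (abs_nonneg _) (h₀ i).le) (Finset.mem_univ i)
        rw [div_le_iff₀ (h₀ i)] at h1
        rw [add_dotProduct, smul_dotProduct, smul_eq_mul]
        have := neg_abs_le (q ⬝ᵥ g i)
        linarith
      rw [add_dotProduct, smul_dotProduct, ← h] at this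
      simpa using this
    have h2 : y ⬝ᵥ y = 0 := by
      refine le_antisymm ?_ (hle y)
      simpa using hle (-y)
    simpa using dotProduct_self_eq_zero.1 h2
  · set S := convexHull ℝ (Set.range fun i => (q₀ ⬝ᵥ g i)⁻¹ • g i) with hS
    have hcomp : IsCompact S := (Set.finite_range _).isCompact_convexHull ℝ
    have hmem : (q₀ ⬝ᵥ y)⁻¹ • y ∈ S := by
      by_contra hn
      obtain ⟨f, u, hu, hf⟩ := geometric_hahn_banach_point_closed (convex_convexHull ℝ _)
        hcomp.isClosed hn
      set q : κ → ℝ := fun k => f (Pi.single k 1) with hq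
      have hfq : ∀ x : κ → ℝ, f x = q ⬝ᵥ x := by
        intro x
        conv_lhs => rw [← Finset.univ_sum_single x]
        simp only [map_sum, dotProduct, hq]
        refine Finset.sum_congr rfl fun k _ => ?_
        rw [← mul_one (x k), ← smul_eq_mul, Pi.single_smul, map_smul, smul_eq_mul, mul_comm,
          smul_eq_mul, mul_one]
      -- On that hyperplane the constant `u` is the linear functional `u • q₀`, which makes the
      -- affine separation homogeneous.
      have := hy (q - u • q₀) fun i => by
        have h1 := hf _ (subset_convexHull ℝ _ (Set.mem_range_self i))
        rw [hfq, dotProduct_smul, smul_eq_mul, inv_mul_eq_div, lt_div_iff₀ (h₀ i)] at h1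
        rw [sub_dotProduct, smul_dotProduct, smul_eq_mul]
        linarith
      rw [hfq, dotProduct_smul, smul_eq_mul, inv_mul_eq_div, div_lt_iff₀ h] at hu
      rw [sub_dotProduct, smul_dotProduct, smul_eq_mul] at this
      linarith
    have hsub : S ⊆ {x | ∃ a : ι → ℝ, (∀ i, 0 ≤ a i) ∧ x = ∑ i, a i • g i} := by
      refine convexHull_min ?_ ?_
      · rintro _ ⟨i, rfl⟩
        classical
        refine ⟨Pi.single i (q₀ ⬝ᵥ g i)⁻¹, fun j => ?_, ?_⟩
        · by_cases hj : j = i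
          · subst hj; simpa using (h₀ j).le
          · simp [hj]
        · rw [Finset.sum_eq_single i (fun j _ hj => by simp [hj]) (by simp)]
          simp
      · rintro _ ⟨a, ha, rfl⟩ _ ⟨b, hb, rfl⟩ s t hs ht -
        refine ⟨fun i => s * a i + t * b i, fun i => ?_, ?_⟩
        · have := ha i; have := hb i; positivity
        · simp [add_smul, Finset.sum_add_distrib, Finset.smul_sum, mul_smul]
    obtain ⟨a, ha, hya⟩ := hsub hmem
    refine ⟨fun i => (q₀ ⬝ᵥ y) * a i, fun i => mul_nonneg h.le (ha i), ?_⟩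
    simp_rw [mul_smul, ← Finset.smul_sum, ← hya, smul_smul, mul_inv_cancel₀ h.ne', one_smul]

/-! ### Compactness and duality for the linear program -/

theorem vecMul_pos_sum_eq {d m n : ℕ} {c : Fin (m + 1) → ℝ} (hc : V d m *ᵥ c = 1)
    (Q : Matrix (Fin (n + 1)) (Fin (m + 1)) ℝ) :
    ∑ k, ∑ l, Q k l = ∑ k, ∑ j, (Q * V d m) k j * c j := by
  have h : ∀ k, ∑ l, Q k l = ((Q * V d m) *ᵥ c) k := by
    intro k
    rw [← Matrix.mulVec_mulVec, hc]
    simp [Matrix.mulVec, dotProduct]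
  simp_rw [h]
  rfl

/-- The normalisation is a strictly positive combination of the nonnegative entries of `Q * V`, so
these lie in a box; invertibility of `V` carries the bound back to `Q`. -/
theorem isCompact_feasible {d : ℕ} (hd : 2 ≤ d) (n m : ℕ) : IsCompact (feasible d n m) := by
  obtain ⟨c, hc0, hc⟩ := exists_pos_V_mulVec_eq_one hd m
  have hbox : IsCompact (Set.pi Set.univ fun _ : Fin (n + 1) =>
      Set.pi Set.univ fun j : Fin (m + 1) => Set.Icc (0 : ℝ) (1 / c j)) :=
    isCompact_univ_pi fun _ => isCompact_univ_pi fun _ => isCompact_Icc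
  have himg := hbox.image (f := fun B : Matrix (Fin (n + 1)) (Fin (m + 1)) ℝ => B * (V d m)⁻¹)
    (by fun_prop)
  refine himg.of_isClosed_subset ?_ ?_
  · have h1 : IsClosed {Q : Matrix (Fin (n + 1)) (Fin (m + 1)) ℝ |
        ∀ i j, 0 ≤ (Q * V d m) i j} := by
      simp only [Set.ofPred_forall]
      exact isClosed_iInter fun i => isClosed_iInter fun j =>
        isClosed_le continuous_const (by fun_prop)
    have h2 : IsClosed {Q : Matrix (Fin (n + 1)) (Fin (m + 1)) ℝ |
        ∀ j i, 0 ≤ (Qᵀ * V d n) j i} := by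
      simp only [Set.ofPred_forall]
      exact isClosed_iInter fun i => isClosed_iInter fun j =>
        isClosed_le continuous_const (by fun_prop)
    have h3 : IsClosed {Q : Matrix (Fin (n + 1)) (Fin (m + 1)) ℝ | ∑ k, ∑ l, Q k l = 1} :=
      isClosed_eq (by fun_prop) continuous_const
    exact h1.inter (h2.inter h3)
  · rintro Q ⟨h1, -, h3⟩
    refine ⟨Q * V d m, ?_, ?_⟩
    · rw [vecMul_pos_sum_eq hc] at h3
      intro i _ j _
      refine ⟨h1 i j, ?_⟩
      rw [le_div_iff₀ (hc0 j), ← h3]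
      have hnn : ∀ i j, 0 ≤ (Q * V d m) i j * c j := fun i j => mul_nonneg (h1 i j) (hc0 j).le
      exact (Finset.single_le_sum (f := fun j => (Q * V d m) i j * c j)
        (fun j _ => hnn i j) (Finset.mem_univ j)).trans
        (Finset.single_le_sum (f := fun i => ∑ j, (Q * V d m) i j * c j)
        (fun i _ => Finset.sum_nonneg fun j _ => hnn i j) (Finset.mem_univ i))
    · have hdet := (Matrix.isUnit_iff_isUnit_det _).1 (isUnit_V hd m)
      simp [Matrix.mul_assoc, Matrix.mul_nonsing_inv _ hdet]

theorem V_zero_nonneg (d m : ℕ) (j : Fin (m + 1)) : 0 ≤ V d m 0 j := by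
  simp only [V, Matrix.of_apply, Fin.val_zero, pow_zero, one_mul]
  refine Finset.sum_nonneg fun t ht => ?_
  have : t = 0 := by simp at ht; omega
  subst this
  positivity

theorem single_mem_feasible (d n m : ℕ) : Matrix.single 0 0 1 ∈ feasible d n m := by
  refine ⟨fun i j => ?_, fun j i => ?_, ?_⟩
  · by_cases h : i = 0
    · subst h; simpa using V_zero_nonneg d m j
    · simp [Matrix.single_mul_apply_of_ne, h]
  · rw [Matrix.transpose_single]
    by_cases h : j = 0
    · subst h; simpa using V_zero_nonneg d n i
    · simp [Matrix.single_mul_apply_of_ne, h]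
  · simp [Matrix.single_apply, ite_and]

theorem exists_isLeast_objective {d : ℕ} (hd : 2 ≤ d) (n m : ℕ) (p₁ p₂ : ℝ) :
    ∃ val, IsLeast (objective d n m p₁ p₂ '' feasible d n m) val := by
  have hcont : Continuous (objective d n m p₁ p₂) := by
    unfold objective
    fun_prop
  exact ((isCompact_feasible hd n m).image hcont).exists_isLeast
    ⟨_, Set.mem_image_of_mem _ (single_mem_feasible d n m)⟩

/-- Nonnegativity on the feasible set extends to the cone that it spans. -/
theorem objective_nonneg_of_cone {d : ℕ} (hd : 2 ≤ d) {n m : ℕ} {p₁ p₂ : ℝ}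
    (h : ∀ Q ∈ feasible d n m, 0 ≤ objective d n m p₁ p₂ Q)
    (Q : Matrix (Fin (n + 1)) (Fin (m + 1)) ℝ) (h1 : ∀ i j, 0 ≤ (Q * V d m) i j)
    (h2 : ∀ j i, 0 ≤ (Qᵀ * V d n) j i) : 0 ≤ objective d n m p₁ p₂ Q := by
  obtain ⟨c, hc0, hc⟩ := exists_pos_V_mulVec_eq_one hd m
  have hs := vecMul_pos_sum_eq hc Q
  have hnn : ∀ i j, 0 ≤ (Q * V d m) i j * c j := fun i j => mul_nonneg (h1 i j) (hc0 j).le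
  have hnn' : ∀ i, 0 ≤ ∑ j, (Q * V d m) i j * c j := fun i => Finset.sum_nonneg fun j _ => hnn i j
  have hs0 : 0 ≤ ∑ k, ∑ l, Q k l := hs ▸ Finset.sum_nonneg fun i _ => hnn' i
  rcases hs0.eq_or_lt with h0 | h0
  -- Total zero forces `Q * V = 0`, hence `Q = 0`; otherwise dividing by the total gives a feasible
  -- point.
  · rw [← h0, eq_comm, Finset.sum_eq_zero_iff_of_nonneg fun i _ => hnn' i] at hs
    have hB : Q * V d m = 0 := by
      ext i j
      have := (Finset.sum_eq_zero_iff_of_nonneg fun j _ => hnn i j).1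
        (hs i (Finset.mem_univ i)) j (Finset.mem_univ j)
      simpa [(hc0 j).ne'] using this
    have hdet := (Matrix.isUnit_iff_isUnit_det _).1 (isUnit_V hd m)
    have hQ : Q = 0 := by
      rw [← Matrix.mul_one Q, ← Matrix.mul_nonsing_inv _ hdet, ← Matrix.mul_assoc, hB,
        Matrix.zero_mul]
    simp [hQ, objective]
  · set s := ∑ k, ∑ l, Q k l with hsdef
    have := h (s⁻¹ • Q) ⟨fun i j => ?_, fun j i => ?_, ?_⟩
    · simp only [objective, Matrix.smul_mulVec, dotProduct_smul, smul_eq_mul] at this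
      exact (mul_nonneg_iff_of_pos_left (inv_pos.2 h0)).1 this
    · simpa using mul_nonneg (inv_pos.2 h0).le (h1 i j)
    · simpa using mul_nonneg (inv_pos.2 h0).le (h2 j i)
    · simp only [Matrix.smul_apply, smul_eq_mul, ← Finset.mul_sum, ← hsdef]
      exact inv_mul_cancel₀ h0.ne'

/-- The dual solution of the linear program. -/
theorem exists_dual_solution {d : ℕ} (hd : 2 ≤ d) {n m : ℕ} {p₁ p₂ : ℝ}
    (h : ∀ Q ∈ feasible d n m, 0 ≤ objective d n m p₁ p₂ Q) :
    ∃ A B : Fin (n + 1) → Fin (m + 1) → ℝ, (∀ k j, 0 ≤ A k j) ∧ (∀ i l, 0 ≤ B i l) ∧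
      ∀ k l, v d n p₁ k * v d m p₂ l = ∑ j, A k j * V d m l j + ∑ i, B i l * V d n k i := by
  classical
  -- The generators are the constraint functionals: `inl` for the entries of `Q * V d m`, `inr` for
  -- those of `Qᵀ * V d n`.
  set g : (Fin (n + 1) × Fin (m + 1)) ⊕ (Fin (n + 1) × Fin (m + 1)) →
      Fin (n + 1) × Fin (m + 1) → ℝ :=
    Sum.elim (fun x y => if y.1 = x.1 then V d m y.2 x.2 else 0)
      (fun x y => if y.2 = x.2 then V d n y.1 x.1 else 0) with hg
  have hl : ∀ (q : Fin (n + 1) × Fin (m + 1) → ℝ) x,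
      q ⬝ᵥ g (Sum.inl x) = ((Matrix.of fun k l => q (k, l)) * V d m) x.1 x.2 := by
    intro q x
    simp [hg, dotProduct, Fintype.sum_prod_type, Matrix.mul_apply]
  have hr : ∀ (q : Fin (n + 1) × Fin (m + 1) → ℝ) x,
      q ⬝ᵥ g (Sum.inr x) = ((Matrix.of fun k l => q (k, l))ᵀ * V d n) x.2 x.1 := by
    intro q x
    simp [hg, dotProduct, Fintype.sum_prod_type, Matrix.mul_apply]
  obtain ⟨a, ha, haV⟩ := exists_pos_vecMul_V_pos hd n
  obtain ⟨b, hb, hbV⟩ := exists_pos_vecMul_V_pos hd m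
  -- The product of the two positive vectors satisfies all inequality constraints strictly, which
  -- provides the open half-space.
  obtain ⟨w, hw, hsum⟩ := exists_nonneg_sum_eq g (fun x => a x.1 * b x.2) (by
      rintro (x | x)
      · rw [hl]
        have : ((Matrix.of fun k l => a k * b l) * V d m) x.1 x.2 = a x.1 * (b ᵥ* V d m) x.2 := by
          simp [Matrix.mul_apply, Matrix.vecMul, dotProduct, Finset.mul_sum, mul_assoc]
        rw [this]
        exact mul_pos (ha _) (hbV _)
      · rw [hr]
        have : ((Matrix.of fun k l => a k * b l)ᵀ * V d n) x.2 x.1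
            = b x.2 * (a ᵥ* V d n) x.1 := by
          simp [Matrix.mul_apply, Matrix.vecMul, dotProduct, Finset.mul_sum, mul_assoc,
            mul_left_comm]
        rw [this]
        exact mul_pos (hb _) (haV _))
    (fun x => v d n p₁ x.1 * v d m p₂ x.2) (by
      intro q hq
      have := objective_nonneg_of_cone hd h (Matrix.of fun k l => q (k, l))
        (fun i j => by rw [← hl q (i, j)]; exact hq _)
        (fun j i => by rw [← hr q (i, j)]; exact hq _)
      convert this using 1
      simp [objective, dotProduct, Matrix.mulVec, Fintype.sum_prod_type, Finset.mul_sum,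
        mul_left_comm])
  refine ⟨fun k j => w (Sum.inl (k, j)), fun i l => w (Sum.inr (i, l)), fun _ _ => hw _,
    fun _ _ => hw _, fun k l => ?_⟩
  have := congrFun hsum (k, l)
  simp only [Finset.sum_apply, Fintype.sum_sum_type, Pi.smul_apply, smul_eq_mul, hg, Sum.elim_inl,
    Sum.elim_inr, Fintype.sum_prod_type, mul_ite, mul_zero] at this
  rw [this]
  congr 1
  · rw [Finset.sum_comm]
    simp
  · simp

/-! ### Positivity, partial transposition and Choi's theorem -/

open scoped MatrixOrder in
/-- A positive semidefinite matrix is of the form `Bᴴ * B`. -/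
theorem _root_.Matrix.PosSemidef.exists_eq_conjTranspose_mul {ι : Type} [Fintype ι]
    {M : Matrix ι ι ℂ} (h : M.PosSemidef) : ∃ B : Matrix ι ι ℂ, M = Bᴴ * B := by
  classical
  exact CStarAlgebra.nonneg_iff_eq_star_mul_self.1 h.nonneg

theorem trace_mul_nonneg {ι : Type} [Fintype ι] {M N : Matrix ι ι ℂ} (hM : M.PosSemidef)
    (hN : N.PosSemidef) : 0 ≤ (M * N).trace := by
  obtain ⟨B, rfl⟩ := hM.exists_eq_conjTranspose_mul
  rw [Matrix.mul_assoc, Matrix.trace_mul_comm, Matrix.mul_assoc]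
  rw [← Matrix.mul_assoc]
  exact (hN.mul_mul_conjTranspose_same B).trace_nonneg

/-- The partial transpose on the second tensor factor. -/
def partialTranspose {a b : Type} (M : Matrix (a × b) (a × b) ℂ) : Matrix (a × b) (a × b) ℂ :=
  Matrix.of fun x y => M (x.1, y.2) (y.1, x.2)

/-- Self-adjointness of the partial transpose for the trace pairing: it moves `Γ` from the summand
`B^Γ` onto the witness. -/
theorem trace_partialTranspose_mul {a b : Type} [Fintype a] [Fintype b]
    (M N : Matrix (a × b) (a × b) ℂ) :
    (partialTranspose M * N).trace = (M * partialTranspose N).trace := by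
  simp only [Matrix.trace, Matrix.diag_apply, Matrix.mul_apply, partialTranspose, Matrix.of_apply,
    Fintype.sum_prod_type]
  refine Finset.sum_congr rfl fun i _ => ?_
  rw [Finset.sum_comm]
  conv_rhs => rw [Finset.sum_comm]
  refine Finset.sum_congr rfl fun j _ => ?_
  rw [Finset.sum_comm]

theorem choi_transposition_comp {a b : Type} [DecidableEq a] (L : MatMap a b) :
    choi ((transposition b).comp L) = partialTranspose (choi L) := by
  ext x y
  simp [choi_apply, transposition, partialTranspose]

theorem choi_add {a b : Type} [DecidableEq a] (L L' : MatMap a b) :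
    choi (L + L') = choi L + choi L' := by
  ext x y
  simp [choi_apply]

theorem choi_injective {a b : Type} [Fintype a] [DecidableEq a] :
    Function.Injective (choi : MatMap a b → _) :=
  Function.LeftInverse.injective ofChoi_choi

theorem posSemidef_omega (a : Type) [DecidableEq a] [Fintype a] : (omega a).PosSemidef := by
  have := Matrix.posSemidef_vecMulVec_self_star
    (fun x : a × a => if x.1 = x.2 then (1 : ℂ) else 0)
  have hs : (star fun x : a × a => if x.1 = x.2 then (1 : ℂ) else 0)
      = fun x => if x.1 = x.2 then 1 else 0 := by
    funext x
    simp [apply_ite]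
  rwa [hs] at this

theorem isCompletelyPositive_iff_posSemidef_choi {a b : Type} [Fintype a] [DecidableEq a]
    [Fintype b] (L : MatMap a b) : IsCompletelyPositive L ↔ (choi L).PosSemidef := by
  constructor
  · intro h
    -- Complete positivity quantifies over `Fin k` only, so `ω` is relabelled along `a ≃ Fin (card
    -- a)` and back.
    let e := Fintype.equivFin a
    have h1 := h _ _ ((posSemidef_omega a).submatrix (Prod.map e.symm (id : a → a)))
    have h2 := h1.submatrix (Prod.map e (id : b → b))
    convert h2 using 1
    ext x y
    simp [choi, ampliation, Matrix.submatrix_apply]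
  · intro h k X hX
    obtain ⟨B, hB⟩ := h.exists_eq_conjTranspose_mul
    obtain ⟨D, rfl⟩ := hX.exists_eq_conjTranspose_mul
    -- Rows of `B` act as Kraus operators; applying them to the rows of the Gram factor `D` gives a
    -- Gram factor of the image.
    let G : Matrix ((Fin k × a) × (a × b)) (Fin k × b) ℂ :=
      Matrix.of fun p x => ∑ i, D p.1 (x.1, i) * B p.2 (i, x.2)
    convert Matrix.posSemidef_conjTranspose_mul_self G using 1
    ext x y
    rw [← ofChoi_choi L, hB]
    simp only [ampliation, ofChoi, LinearMap.coe_mk, AddHom.coe_mk, Matrix.of_apply,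
      Matrix.mul_apply, Matrix.conjTranspose_apply, G, star_sum, star_mul', Finset.sum_mul_sum]
    conv_rhs => rw [Finset.sum_comm]
    refine Finset.sum_congr rfl fun i _ => ?_
    conv_rhs => rw [Finset.sum_comm]
    refine Finset.sum_congr rfl fun j _ => ?_
    simp only [Fintype.sum_prod_type (α₁ := Fin k × a) (α₂ := a × b)]
    refine Finset.sum_congr rfl fun p _ => Finset.sum_congr rfl fun q _ => ?_
    ring

theorem isDecomposable_iff_choi {a b : Type} [Fintype a] [DecidableEq a] [Fintype b]
    (L : MatMap a b) : IsDecomposable L ↔ ∃ A B : Matrix (a × b) (a × b) ℂ,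
      A.PosSemidef ∧ B.PosSemidef ∧ choi L = A + partialTranspose B := by
  constructor
  · rintro ⟨T₁, T₂, h₁, h₂, rfl⟩
    exact ⟨_, _, (isCompletelyPositive_iff_posSemidef_choi _).1 h₁,
      (isCompletelyPositive_iff_posSemidef_choi _).1 h₂, by
        rw [choi_add, choi_transposition_comp]⟩
  · rintro ⟨A, B, hA, hB, h⟩
    refine ⟨ofChoi A, ofChoi B, ?_, ?_, choi_injective ?_⟩
    · rwa [isCompletelyPositive_iff_posSemidef_choi, choi_ofChoi]
    · rwa [isCompletelyPositive_iff_posSemidef_choi, choi_ofChoi]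
    · rw [choi_add, choi_transposition_comp, choi_ofChoi, choi_ofChoi, h]

/-! ### Tensor products of bipartite matrices -/

section Tensor

variable {ι a b : Type} [Fintype ι]

/-- The tensor product of bipartite matrices, regarded as a bipartite matrix. -/
def tensorChoi (M : ι → Matrix (a × b) (a × b) ℂ) :
    Matrix ((ι → a) × (ι → b)) ((ι → a) × (ι → b)) ℂ :=
  Matrix.of fun x y => ∏ k, M k (x.1 k, x.2 k) (y.1 k, y.2 k)

theorem choi_tensorMap [DecidableEq ι] [Fintype a] [DecidableEq a] (L : ι → MatMap a b) :
    choi (tensorMap L) = tensorChoi fun k => choi (L k) := by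
  ext x y
  rw [choi_apply]
  simp only [tensorMap, LinearMap.coe_mk, AddHom.coe_mk, Matrix.sum_apply, Matrix.smul_apply,
    Matrix.single_apply, tensorChoi, Matrix.of_apply, choi_apply, tensorMatrix]
  rw [Finset.sum_eq_single x.1 (by intro i _ hi; simp [hi.symm]) (by simp),
    Finset.sum_eq_single y.1 (by intro i _ hi; simp [hi.symm]) (by simp)]
  simp

theorem partialTranspose_tensorChoi (M : ι → Matrix (a × b) (a × b) ℂ) :
    partialTranspose (tensorChoi M) = tensorChoi fun k => partialTranspose (M k) := rfl

theorem sum_prod_arrow [DecidableEq ι] [Fintype a] [Fintype b] (f : ι → a × b → ℂ) :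
    ∑ x : (ι → a) × (ι → b), ∏ k, f k (x.1 k, x.2 k) = ∏ k, ∑ x, f k x := by
  have := Finset.prod_univ_sum (fun _ : ι => (Finset.univ : Finset (a × b))) f
  rw [this, Fintype.piFinset_univ]
  exact (Equiv.sum_comp (Equiv.arrowProdEquivProdArrow ι (fun _ => a) (fun _ => b))
    (fun x : (ι → a) × (ι → b) => ∏ k, f k (x.1 k, x.2 k))).symm

theorem tensorChoi_mul [DecidableEq ι] [Fintype a] [Fintype b]
    (M N : ι → Matrix (a × b) (a × b) ℂ) :
    tensorChoi M * tensorChoi N = tensorChoi fun k => M k * N k := by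
  ext x y
  simp only [tensorChoi, Matrix.mul_apply, Matrix.of_apply, ← Finset.prod_mul_distrib]
  exact sum_prod_arrow fun k z => M k (x.1 k, x.2 k) z * N k z (y.1 k, y.2 k)

theorem trace_tensorChoi [DecidableEq ι] [Fintype a] [Fintype b]
    (M : ι → Matrix (a × b) (a × b) ℂ) : (tensorChoi M).trace = ∏ k, (M k).trace :=
  sum_prod_arrow fun k z => M k z z

theorem conjTranspose_tensorChoi (M : ι → Matrix (a × b) (a × b) ℂ) :
    (tensorChoi M)ᴴ = tensorChoi fun k => (M k)ᴴ := by
  ext x y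
  simp [tensorChoi]

/-- Gram factors tensor. -/
theorem posSemidef_tensorChoi [DecidableEq ι] [Fintype a] [Fintype b]
    {M : ι → Matrix (a × b) (a × b) ℂ} (h : ∀ k, (M k).PosSemidef) :
    (tensorChoi M).PosSemidef := by
  choose B hB using fun k => (h k).exists_eq_conjTranspose_mul
  have : tensorChoi M = (tensorChoi B)ᴴ * tensorChoi B := by
    rw [conjTranspose_tensorChoi, tensorChoi_mul]
    congr 1
    funext k
    exact hB k
  rw [this]
  exact Matrix.posSemidef_conjTranspose_mul_self _

/-- Multilinearity in one block of sites: one-site expansions become sums over strings. -/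
theorem tensorChoi_sumElim_right {ι' : Type} [Fintype ι'] [DecidableEq ι']
    (F : ι → Matrix (a × b) (a × b) ℂ) (c : ι' → Bool → ℝ) (H : Bool → Matrix (a × b) (a × b) ℂ) :
    tensorChoi (Sum.elim F fun k => ∑ s, c k s • H s)
      = ∑ τ : ι' → Bool, (∏ k, c k (τ k)) • tensorChoi (Sum.elim F fun k => H (τ k)) := by
  ext x y
  simp only [tensorChoi, Matrix.of_apply, Fintype.prod_sum_type, Sum.elim_inl, Sum.elim_inr,
    Matrix.sum_apply, Matrix.smul_apply, Complex.real_smul, Complex.ofReal_prod]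
  rw [Finset.prod_univ_sum, Fintype.piFinset_univ, Finset.mul_sum]
  refine Finset.sum_congr rfl fun τ _ => ?_
  rw [Finset.prod_mul_distrib]
  ring

theorem tensorChoi_sumElim_left {ι' : Type} [Fintype ι'] [DecidableEq ι']
    (F : ι → Matrix (a × b) (a × b) ℂ) (c : ι' → Bool → ℝ) (H : Bool → Matrix (a × b) (a × b) ℂ) :
    tensorChoi (Sum.elim (fun k => ∑ s, c k s • H s) F)
      = ∑ τ : ι' → Bool, (∏ k, c k (τ k)) • tensorChoi (Sum.elim (fun k => H (τ k)) F) := by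
  ext x y
  simp only [tensorChoi, Matrix.of_apply, Fintype.prod_sum_type, Sum.elim_inl, Sum.elim_inr,
    Matrix.sum_apply, Matrix.smul_apply, Complex.real_smul, Complex.ofReal_prod]
  rw [Finset.prod_univ_sum, Fintype.piFinset_univ, Finset.sum_mul]
  refine Finset.sum_congr rfl fun τ _ => ?_
  rw [Finset.prod_mul_distrib]
  ring

end Tensor

/-! ### Werner and isotropic matrices at one site -/

/-- The symmetric (`false`) and antisymmetric (`true`) projectors. -/
def wernerProj (d : ℕ) (s : Bool) : Matrix (Fin d × Fin d) (Fin d × Fin d) ℂ :=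
  cond s (Pasym d) (Psym d)

/-- Generators of the extreme rays of the positive cone spanned by `1` and `ω`. -/
def isoProj (d : ℕ) (s : Bool) : Matrix (Fin d × Fin d) (Fin d × Fin d) ℂ :=
  cond s (((d : ℝ) / ((d : ℝ) - 1)) • 1 - (1 / ((d : ℝ) - 1)) • omega (Fin d)) (omega (Fin d))

/-- The ranks of `wernerProj`. -/
def wernerRank (d : ℕ) (s : Bool) : ℝ :=
  cond s ((d : ℝ) * (d - 1) / 2) ((d : ℝ) * (d + 1) / 2)

/-- The squared Hilbert--Schmidt norms of `isoProj`. -/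
def isoNormSq (d : ℕ) (s : Bool) : ℝ :=
  cond s ((d : ℝ) ^ 2 * (d + 1) / (d - 1)) ((d : ℝ) ^ 2)

theorem wernerRank_pos {d : ℕ} (hd : 2 ≤ d) (s : Bool) : 0 < wernerRank d s := by
  have : (2 : ℝ) ≤ d := by exact_mod_cast hd
  have : (0 : ℝ) < d - 1 := by linarith
  cases s <;> simp only [wernerRank, cond_true, cond_false] <;> positivity

theorem isoNormSq_pos {d : ℕ} (hd : 2 ≤ d) (s : Bool) : 0 < isoNormSq d s := by
  have : (2 : ℝ) ≤ d := by exact_mod_cast hd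
  have : (0 : ℝ) < d - 1 := by linarith
  cases s <;> simp only [isoNormSq, cond_true, cond_false] <;> positivity

theorem flip_mul_flip (d : ℕ) : flip d * flip d = 1 := by
  ext x y
  rw [Matrix.mul_apply, Finset.sum_eq_single x.swap]
  · simp [flip, Matrix.one_apply]
  · intro z _ hz
    have : x ≠ z.swap := by rintro rfl; simp at hz
    simp [flip, this]
  · simp

theorem conjTranspose_flip (d : ℕ) : (flip d)ᴴ = flip d := by
  ext x y
  have : y = x.swap ↔ x = y.swap := by
    constructor <;> rintro rfl <;> simp
  simp [flip, apply_ite, this]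

theorem trace_flip (d : ℕ) : (flip d).trace = d := by
  have h : ∀ i j : Fin d, (i = j ∧ j = i) ↔ i = j := fun i j =>
    ⟨And.left, fun h => ⟨h, h.symm⟩⟩
  rw [Matrix.trace, Fintype.sum_prod_type]
  simp [flip, h]

theorem partialTranspose_flip (d : ℕ) : partialTranspose (flip d) = omega (Fin d) := by
  ext x y
  simp [partialTranspose, flip, omega, Matrix.vecMulVec_apply, Prod.ext_iff, ← ite_and, and_comm,
    eq_comm]

theorem partialTranspose_one (d : ℕ) :
    partialTranspose (1 : Matrix (Fin d × Fin d) (Fin d × Fin d) ℂ) = 1 := by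
  ext x y
  simp [partialTranspose, Matrix.one_apply, Prod.ext_iff, eq_comm]

theorem partialTranspose_wernerProj (d : ℕ) (s : Bool) :
    partialTranspose (wernerProj d s)
      = (1 / 2 : ℝ) • (1 : Matrix (Fin d × Fin d) (Fin d × Fin d) ℂ)
        + (cond s (-1 / 2) (1 / 2) : ℝ) • omega (Fin d) := by
  rw [← partialTranspose_flip, ← partialTranspose_one]
  ext x y
  cases s <;> simp [wernerProj, Psym, Pasym, partialTranspose] <;> ring

theorem wernerProj_mul (d : ℕ) (s t : Bool) :
    wernerProj d s * wernerProj d t = if s = t then wernerProj d s else 0 := by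
  have h := flip_mul_flip d
  cases s <;> cases t <;>
    simp [wernerProj, Psym, Pasym, Matrix.mul_add, Matrix.add_mul, Matrix.mul_sub, Matrix.sub_mul,
      h] <;> module

theorem posSemidef_wernerProj (d : ℕ) (s : Bool) : (wernerProj d s).PosSemidef := by
  have h : (wernerProj d s)ᴴ * wernerProj d s = wernerProj d s := by
    have : (wernerProj d s)ᴴ = wernerProj d s := by
      cases s <;> simp [wernerProj, Psym, Pasym, conjTranspose_flip]
    rw [this, wernerProj_mul, if_pos rfl]
  rw [← h]
  exact Matrix.posSemidef_conjTranspose_mul_self _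

theorem trace_wernerProj (d : ℕ) (s : Bool) : (wernerProj d s).trace = (wernerRank d s : ℂ) := by
  cases s <;> simp [wernerProj, wernerRank, Psym, Pasym, trace_flip] <;> ring

theorem omega_mul_omega (d : ℕ) : omega (Fin d) * omega (Fin d) = (d : ℝ) • omega (Fin d) := by
  ext x y
  simp [omega, Matrix.mul_apply, Matrix.vecMulVec_apply, Fintype.sum_prod_type]

theorem posSemidef_isoProj {d : ℕ} (hd : 2 ≤ d) (s : Bool) : (isoProj d s).PosSemidef := by
  have hd' : (2 : ℝ) ≤ d := by exact_mod_cast hd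
  have h1 : (0 : ℝ) < d - 1 := by linarith
  have h0 : (d : ℝ) ≠ 0 := by positivity
  cases s
  · exact posSemidef_omega _
  · have hc : (isoProj d true)ᴴ = isoProj d true := by
      simp [isoProj, (posSemidef_omega (Fin d)).isHermitian.eq]
    -- It is `d / (d - 1)` times the projector `1 - ω / d`, so `(d - 1) / d` times its square
    -- returns it.
    have : isoProj d true = (((d : ℝ) - 1) / d) • ((isoProj d true)ᴴ * isoProj d true) := by
      rw [hc]
      simp only [isoProj, cond_true, Matrix.mul_sub, Matrix.sub_mul, Matrix.smul_mul,
        Matrix.mul_smul, omega_mul_omega, Matrix.one_mul, Matrix.mul_one]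
      match_scalars <;> field_simp <;> ring
    rw [this]
    exact (Matrix.posSemidef_conjTranspose_mul_self _).smul (by positivity)

/-- The change of basis at a site. -/
theorem isoProj_eq {d : ℕ} (hd : 2 ≤ d) (s : Bool) :
    isoProj d s = ∑ t, siteCoeff d t s • partialTranspose (wernerProj d t) := by
  have hd' : (2 : ℝ) ≤ d := by exact_mod_cast hd
  have h1 : (d : ℝ) - 1 ≠ 0 := by linarith
  cases s <;> simp only [isoProj, Fintype.sum_bool, partialTranspose_wernerProj, siteCoeff,
    cond_true, cond_false, ratio] <;> match_scalars <;> field_simp <;> ring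

/-- The dual change of basis at a site. -/
theorem partialTranspose_dual_eq {d : ℕ} (hd : 2 ≤ d) (t : Bool) :
    partialTranspose ((wernerRank d t)⁻¹ • wernerProj d t)
      = ∑ s, siteCoeff d t s • (isoNormSq d s)⁻¹ • isoProj d s := by
  have hd' : (2 : ℝ) ≤ d := by exact_mod_cast hd
  have h1 : (d : ℝ) - 1 ≠ 0 := by linarith
  have h0 : (d : ℝ) ≠ 0 := by positivity
  have h2 : (d : ℝ) + 1 ≠ 0 := by positivity
  have : partialTranspose ((wernerRank d t)⁻¹ • wernerProj d t)
      = (wernerRank d t)⁻¹ • partialTranspose (wernerProj d t) := rfl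
  -- The coefficients are again `siteCoeff` because `Γ` is self-adjoint for the trace pairing and
  -- the two `isoProj` are orthogonal with squared norms `isoNormSq`; here this is checked by direct
  -- computation.
  rw [this, partialTranspose_wernerProj]
  cases t <;> simp only [isoProj, Fintype.sum_bool, siteCoeff, wernerRank, isoNormSq,
    cond_true, cond_false, ratio] <;> match_scalars <;> field_simp <;> ring

theorem partialTranspose_smul {a b : Type} (c : ℝ) (M : Matrix (a × b) (a × b) ℂ) :
    partialTranspose (c • M) = c • partialTranspose M := rfl

theorem partialTranspose_partialTranspose {a b : Type} (M : Matrix (a × b) (a × b) ℂ) :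
    partialTranspose (partialTranspose M) = M := rfl

theorem partialTranspose_sum {a b κ : Type} [Fintype κ] (M : κ → Matrix (a × b) (a × b) ℂ) :
    partialTranspose (∑ i, M i) = ∑ i, partialTranspose (M i) := by
  ext x y
  simp [partialTranspose, Matrix.sum_apply]

theorem partialTranspose_sumElim {ι ι' a b : Type} [Fintype ι] [Fintype ι']
    (F : ι → Matrix (a × b) (a × b) ℂ) (G : ι' → Matrix (a × b) (a × b) ℂ) :
    partialTranspose (tensorChoi (Sum.elim F G))
      = tensorChoi (Sum.elim (fun k => partialTranspose (F k)) fun k => partialTranspose (G k)) := by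
  rw [partialTranspose_tensorChoi]
  congr 1
  funext k
  cases k <;> rfl

theorem posSemidef_sumElim {ι ι' a b : Type} [Fintype ι] [Fintype ι'] [DecidableEq ι]
    [DecidableEq ι'] [Fintype a] [Fintype b]
    {F : ι → Matrix (a × b) (a × b) ℂ} {G : ι' → Matrix (a × b) (a × b) ℂ}
    (hF : ∀ k, (F k).PosSemidef) (hG : ∀ k, (G k).PosSemidef) :
    (tensorChoi (Sum.elim F G)).PosSemidef :=
  posSemidef_tensorChoi (Sum.rec hF hG)

/-! ### The Choi matrix of the mixed power -/

/-- The weight of `P_sym` or `P_asym` in the Werner state, up to the factor `2 / (d (d + 1))`. -/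
def wernerWeight (d : ℕ) (p : ℝ) (s : Bool) : ℝ := cond s (ratio d * (1 - p)) p

theorem wernerState_eq {d : ℕ} (hd : 2 ≤ d) (p : ℝ) :
    wernerState d p
      = ∑ s, ((wernerRank d false)⁻¹ * wernerWeight d p s) • wernerProj d s := by
  have hd' : (2 : ℝ) ≤ d := by exact_mod_cast hd
  have h1 : (d : ℝ) - 1 ≠ 0 := by linarith
  have h0 : (d : ℝ) ≠ 0 := by positivity
  have h2 : (d : ℝ) + 1 ≠ 0 := by positivity
  -- The quotient of the two ranks is `ratio d`, so a single normalising factor serves both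
  -- projectors.
  have ht : (wernerRank d false)⁻¹ * wernerWeight d p true = (1 - p) / wernerRank d true := by
    simp only [wernerRank, wernerWeight, ratio, cond_true, cond_false]
    field_simp
  have hf : (wernerRank d false)⁻¹ * wernerWeight d p false = p / wernerRank d false := by
    simp only [wernerWeight, cond_false]
    ring
  have h3 := trace_wernerProj d true
  have h4 := trace_wernerProj d false
  simp only [wernerProj, cond_true, cond_false] at h3 h4
  rw [Fintype.sum_bool, ht, hf, wernerState, h3, h4, add_comm]
  ext x y
  simp [wernerProj]

/-- This is where the vector `v` arises: a product of one-site Werner weights depends only on the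
number of antisymmetric sites. -/
theorem prod_wernerWeight (d : ℕ) {m : ℕ} (p : ℝ) (c : ℝ) (t : Fin m → Bool) :
    ∏ k, (c * wernerWeight d p (t k)) = c ^ m * v d m p (wt t) := by
  rw [Finset.prod_mul_distrib, prod_comp_eq_pow_wt]
  simp only [wernerWeight, cond_true, cond_false, Finset.prod_const, Finset.card_univ,
    Fintype.card_fin, v, ratio, mul_pow]
  ring

/-- The symmetric basis of the mixed Werner algebra. -/
def mixedBasis (d : ℕ) {n m : ℕ} (s : Fin n → Bool) (t : Fin m → Bool) :=
  tensorChoi (Sum.elim (fun k => wernerProj d (s k)) fun k => partialTranspose (wernerProj d (t k)))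

theorem choi_mixedPower {d : ℕ} (hd : 2 ≤ d) (n m : ℕ) (p₁ p₂ : ℝ) :
    choi (mixedPower d n m p₁ p₂) = ∑ s : Fin n → Bool, ∑ t : Fin m → Bool,
      (((wernerRank d false)⁻¹ ^ n * (wernerRank d false)⁻¹ ^ m) *
        (v d n p₁ (wt s) * v d m p₂ (wt t))) • mixedBasis d s t := by
  have h : (fun k => choi (Sum.elim (fun _ : Fin n => wernerMap d p₁)
      (fun _ : Fin m => (transposition (Fin d)).comp (wernerMap d p₂)) k))
      = Sum.elim (fun _ => ∑ s, ((wernerRank d false)⁻¹ * wernerWeight d p₁ s) • wernerProj d s)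
        (fun _ => ∑ s, ((wernerRank d false)⁻¹ * wernerWeight d p₂ s) •
          partialTranspose (wernerProj d s)) := by
    funext k
    rcases k with k | k
    · simp only [Sum.elim_inl, wernerMap, choi_ofChoi, wernerState_eq hd]
    · simp only [Sum.elim_inr, choi_transposition_comp, wernerMap, choi_ofChoi, wernerState_eq hd,
        partialTranspose_sum, partialTranspose_smul]
  rw [mixedPower, choi_tensorMap, h, tensorChoi_sumElim_left]
  refine Finset.sum_congr rfl fun s _ => ?_
  rw [tensorChoi_sumElim_right (fun k => wernerProj d (s k))
    (fun _ s => (wernerRank d false)⁻¹ * wernerWeight d p₂ s)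
    (fun s => partialTranspose (wernerProj d s)), Finset.smul_sum]
  refine Finset.sum_congr rfl fun t _ => ?_
  rw [smul_smul, prod_wernerWeight, prod_wernerWeight]
  congr 1
  ring

theorem sum_mul_V_eq (d : ℕ) {m : ℕ} (f : Fin (m + 1) → ℝ) (t : Fin m → Bool) :
    ∑ j, f j * V d m (wt t) j = ∑ τ, f (wt τ) * stringCoeff d t τ := by
  simp_rw [← sum_stringCoeff_wt, Finset.mul_sum]
  rw [Finset.sum_comm]
  simp

/-! ### From dual multipliers to a decomposition -/

/-- A dual solution yields a decomposition. -/
theorem isDecomposable_of_dual_solution {d : ℕ} (hd : 2 ≤ d) {n m : ℕ} {p₁ p₂ : ℝ}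
    {A B : Fin (n + 1) → Fin (m + 1) → ℝ} (hA : ∀ k j, 0 ≤ A k j) (hB : ∀ i l, 0 ≤ B i l)
    (h : ∀ k l, v d n p₁ k * v d m p₂ l = ∑ j, A k j * V d m l j + ∑ i, B i l * V d n k i) :
    IsDecomposable (mixedPower d n m p₁ p₂) := by
  set K := (wernerRank d false)⁻¹ ^ n * (wernerRank d false)⁻¹ ^ m with hK
  have hK0 : 0 ≤ K := by
    have := wernerRank_pos hd false
    positivity
  rw [isDecomposable_iff_choi]
  -- The multipliers `A` weight products of Werner projectors with `isoProj`; `B` does so with the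
  -- blocks exchanged, since its sum is partially transposed afterwards.
  refine ⟨∑ s : Fin n → Bool, ∑ τ : Fin m → Bool, (K * A (wt s) (wt τ)) •
      tensorChoi (Sum.elim (fun k => wernerProj d (s k)) fun k => isoProj d (τ k)),
    ∑ σ : Fin n → Bool, ∑ t : Fin m → Bool, (K * B (wt σ) (wt t)) •
      tensorChoi (Sum.elim (fun k => isoProj d (σ k)) fun k => wernerProj d (t k)), ?_, ?_, ?_⟩
  · exact Matrix.posSemidef_sum _ fun s _ => Matrix.posSemidef_sum _ fun τ _ =>
      (posSemidef_sumElim (fun k => posSemidef_wernerProj d _)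
        fun k => posSemidef_isoProj hd _).smul (mul_nonneg hK0 (hA _ _))
  · exact Matrix.posSemidef_sum _ fun s _ => Matrix.posSemidef_sum _ fun τ _ =>
      (posSemidef_sumElim (fun k => posSemidef_isoProj hd _)
        fun k => posSemidef_wernerProj d _).smul (mul_nonneg hK0 (hB _ _))
  · have h1 : ∀ (s : Fin n → Bool) (τ : Fin m → Bool),
        tensorChoi (Sum.elim (fun k => wernerProj d (s k)) fun k => isoProj d (τ k))
          = ∑ t, stringCoeff d t τ • mixedBasis d s t := by
      intro s τ
      simp_rw [isoProj_eq hd]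
      exact tensorChoi_sumElim_right (fun k => wernerProj d (s k))
        (fun k t => siteCoeff d t (τ k)) (fun t => partialTranspose (wernerProj d t))
    have h2 : ∀ (σ : Fin n → Bool) (t : Fin m → Bool),
        partialTranspose
          (tensorChoi (Sum.elim (fun k => isoProj d (σ k)) fun k => wernerProj d (t k)))
          = ∑ s, stringCoeff d s σ • mixedBasis d s t := by
      intro σ t
      rw [partialTranspose_sumElim]
      simp_rw [isoProj_eq hd, partialTranspose_sum, partialTranspose_smul,
        partialTranspose_partialTranspose]
      exact tensorChoi_sumElim_left (fun k => partialTranspose (wernerProj d (t k)))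
        (fun k s => siteCoeff d s (σ k)) (wernerProj d)
    simp_rw [choi_mixedPower hd, h, sum_mul_V_eq d (A _)]
    simp_rw [fun l => sum_mul_V_eq d (fun i => B i l)]
    simp_rw [partialTranspose_sum, partialTranspose_smul, h1, h2, Finset.smul_sum, smul_smul,
      ← hK, mul_add, add_smul, Finset.sum_add_distrib, Finset.mul_sum, Finset.sum_smul]
    congr 1
    · refine Finset.sum_congr rfl fun s _ => ?_
      rw [Finset.sum_comm]
      simp_rw [mul_assoc]
    · rw [Finset.sum_comm]
      conv_rhs => rw [Finset.sum_comm]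
      refine Finset.sum_congr rfl fun t _ => ?_
      rw [Finset.sum_comm]
      simp_rw [mul_assoc]

/-! ### Witnesses from feasible points -/

/-- The basis dual to `wernerProj` for the trace pairing. -/
def wernerDual (d : ℕ) (s : Bool) : Matrix (Fin d × Fin d) (Fin d × Fin d) ℂ :=
  (wernerRank d s)⁻¹ • wernerProj d s

/-- The positive partial transpose witness attached to a point of the cone of the linear
program. -/
def witness (d : ℕ) {n m : ℕ} (Q : Matrix (Fin (n + 1)) (Fin (m + 1)) ℝ) :=
  ∑ s : Fin n → Bool, ∑ t : Fin m → Bool,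
    (Q (wt s) (wt t) / ((n.choose (wt s) : ℝ) * m.choose (wt t))) •
      tensorChoi (Sum.elim (fun k => wernerDual d (s k)) fun k =>
        partialTranspose (wernerDual d (t k)))

theorem posSemidef_wernerDual {d : ℕ} (hd : 2 ≤ d) (s : Bool) : (wernerDual d s).PosSemidef :=
  (posSemidef_wernerProj d s).smul (inv_pos.2 (wernerRank_pos hd s)).le

/-- Expanding the last `m` sites in `isoProj` turns the coefficients into entries of `Q * V d m`
divided by binomials, on positive semidefinite products. -/
theorem posSemidef_witness {d : ℕ} (hd : 2 ≤ d) {n m : ℕ}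
    {Q : Matrix (Fin (n + 1)) (Fin (m + 1)) ℝ} (hQ : ∀ i j, 0 ≤ (Q * V d m) i j) :
    (witness d Q).PosSemidef := by
  have h : witness d Q = ∑ s : Fin n → Bool, ∑ τ : Fin m → Bool,
      ((Q * V d m) (wt s) (wt τ) / m.choose (wt τ) / n.choose (wt s)) •
        tensorChoi (Sum.elim (fun k => wernerDual d (s k)) fun k =>
          (isoNormSq d (τ k))⁻¹ • isoProj d (τ k)) := by
    refine Finset.sum_congr rfl fun s _ => ?_
    have hV : ∀ τ, (Q * V d m) (wt s) (wt τ) / m.choose (wt τ)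
        = ∑ t, Q (wt s) (wt t) / (m.choose (wt t)) * stringCoeff d t τ := fun τ =>
      (sum_mul_stringCoeff d (fun l => Q (wt s) l) τ).symm
    simp_rw [hV, Finset.sum_div, Finset.sum_smul]
    rw [Finset.sum_comm]
    refine Finset.sum_congr rfl fun t _ => ?_
    have := tensorChoi_sumElim_right (fun k => wernerDual d (s k))
      (fun k τ => siteCoeff d (t k) τ) (fun τ => (isoNormSq d τ)⁻¹ • isoProj d τ)
    simp_rw [← partialTranspose_dual_eq hd] at this
    rw [show (fun k => partialTranspose (wernerDual d (t k))) = fun k =>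
      partialTranspose ((wernerRank d (t k))⁻¹ • wernerProj d (t k)) from rfl, this,
      Finset.smul_sum]
    refine Finset.sum_congr rfl fun τ _ => ?_
    rw [smul_smul]
    congr 1
    rw [stringCoeff]
    ring
  rw [h]
  exact Matrix.posSemidef_sum _ fun s _ => Matrix.posSemidef_sum _ fun τ _ =>
    (posSemidef_sumElim (fun k => posSemidef_wernerDual hd _)
      fun k => (posSemidef_isoProj hd _).smul (inv_pos.2 (isoNormSq_pos hd _)).le).smul
      (div_nonneg (div_nonneg (hQ _ _) (Nat.cast_nonneg _)) (Nat.cast_nonneg _))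

/-- After `Γ` the first `n` sites carry the partial transposes, so the roles of the blocks swap and
`Qᵀ * V d n` appears. -/
theorem posSemidef_partialTranspose_witness {d : ℕ} (hd : 2 ≤ d) {n m : ℕ}
    {Q : Matrix (Fin (n + 1)) (Fin (m + 1)) ℝ} (hQ : ∀ j i, 0 ≤ (Qᵀ * V d n) j i) :
    (partialTranspose (witness d Q)).PosSemidef := by
  have h : partialTranspose (witness d Q) = ∑ t : Fin m → Bool, ∑ σ : Fin n → Bool,
      ((Qᵀ * V d n) (wt t) (wt σ) / n.choose (wt σ) / m.choose (wt t)) •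
        tensorChoi (Sum.elim (fun k => (isoNormSq d (σ k))⁻¹ • isoProj d (σ k))
          fun k => wernerDual d (t k)) := by
    simp_rw [witness, partialTranspose_sum, partialTranspose_smul, partialTranspose_sumElim,
      partialTranspose_partialTranspose]
    rw [Finset.sum_comm]
    refine Finset.sum_congr rfl fun t _ => ?_
    have hV : ∀ σ, (Qᵀ * V d n) (wt t) (wt σ) / n.choose (wt σ)
        = ∑ s, Q (wt s) (wt t) / (n.choose (wt s)) * stringCoeff d s σ := fun σ =>
      (sum_mul_stringCoeff d (fun k => Q k (wt t)) σ).symm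
    simp_rw [hV, Finset.sum_div, Finset.sum_smul]
    rw [Finset.sum_comm]
    refine Finset.sum_congr rfl fun s _ => ?_
    have := tensorChoi_sumElim_left (fun k => wernerDual d (t k))
      (fun k σ => siteCoeff d (s k) σ) (fun σ => (isoNormSq d σ)⁻¹ • isoProj d σ)
    simp_rw [← partialTranspose_dual_eq hd] at this
    rw [show (fun k => partialTranspose (wernerDual d (s k))) = fun k =>
      partialTranspose ((wernerRank d (s k))⁻¹ • wernerProj d (s k)) from rfl, this,
      Finset.smul_sum]
    refine Finset.sum_congr rfl fun σ _ => ?_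
    rw [smul_smul]
    congr 1
    rw [stringCoeff]
    ring
  rw [h]
  exact Matrix.posSemidef_sum _ fun s _ => Matrix.posSemidef_sum _ fun τ _ =>
    (posSemidef_sumElim (fun k => (posSemidef_isoProj hd _).smul
      (inv_pos.2 (isoNormSq_pos hd _)).le) fun k => posSemidef_wernerDual hd _).smul
      (div_nonneg (div_nonneg (hQ _ _) (Nat.cast_nonneg _)) (Nat.cast_nonneg _))

theorem trace_wernerDual_mul {d : ℕ} (hd : 2 ≤ d) (s t : Bool) :
    (wernerDual d s * wernerProj d t).trace = if s = t then 1 else 0 := by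
  have : (wernerRank d s : ℂ) ≠ 0 := by exact_mod_cast (wernerRank_pos hd s).ne'
  rw [wernerDual, Matrix.smul_mul, wernerProj_mul, Matrix.trace_smul]
  split_ifs
  · rw [trace_wernerProj, Complex.real_smul, Complex.ofReal_inv, inv_mul_cancel₀ this]
  · simp

theorem trace_dual_mul_mixedBasis {d : ℕ} (hd : 2 ≤ d) {n m : ℕ} (s s' : Fin n → Bool)
    (t t' : Fin m → Bool) :
    (tensorChoi (Sum.elim (fun k => wernerDual d (s k)) fun k =>
      partialTranspose (wernerDual d (t k))) * mixedBasis d s' t').trace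
      = if s = s' ∧ t = t' then 1 else 0 := by
  rw [mixedBasis, tensorChoi_mul, trace_tensorChoi, Fintype.prod_sum_type]
  simp only [Sum.elim_inl, Sum.elim_inr, trace_partialTranspose_mul,
    partialTranspose_partialTranspose, trace_wernerDual_mul hd, Finset.prod_ite_zero,
    Finset.mem_univ, forall_const, Finset.prod_const_one]
  simp only [← funext_iff]
  by_cases h1 : s = s' <;> by_cases h2 : t = t' <;> simp [h1, h2]

/-- By duality of the bases only matching strings survive, and the binomials in `witness` cancel the
sizes of the weight classes. -/
theorem trace_witness_mul_choi {d : ℕ} (hd : 2 ≤ d) {n m : ℕ} (p₁ p₂ : ℝ)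
    (Q : Matrix (Fin (n + 1)) (Fin (m + 1)) ℝ) :
    (witness d Q * choi (mixedPower d n m p₁ p₂)).trace
      = (((wernerRank d false)⁻¹ ^ n * (wernerRank d false)⁻¹ ^ m *
        objective d n m p₁ p₂ Q : ℝ) : ℂ) := by
  set K := (wernerRank d false)⁻¹ ^ n * (wernerRank d false)⁻¹ ^ m with hK
  have h1 : (witness d Q * choi (mixedPower d n m p₁ p₂)).trace
      = ((∑ s : Fin n → Bool, ∑ t : Fin m → Bool,
        Q (wt s) (wt t) / ((n.choose (wt s) : ℝ) * m.choose (wt t)) *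
          (K * (v d n p₁ (wt s) * v d m p₂ (wt t))) : ℝ) : ℂ) := by
    rw [choi_mixedPower hd, ← hK, witness]
    simp only [Matrix.sum_mul, Matrix.mul_sum, Matrix.trace_sum, Matrix.smul_mul, Matrix.mul_smul,
      Matrix.trace_smul, trace_dual_mul_mixedBasis hd, Complex.real_smul, Complex.ofReal_sum]
    refine Finset.sum_congr rfl fun s _ => Finset.sum_congr rfl fun t _ => ?_
    simp [ite_and]
    ring
  have h2 : ∀ (a : ℕ) (k : Fin (a + 1)), (a.choose k : ℝ) ≠ 0 := fun a k => by
    exact_mod_cast (Nat.choose_pos (Nat.le_of_lt_succ k.2)).ne'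
  rw [h1]
  congr 1
  rw [sum_comp_wt (fun k => ∑ t : Fin m → Bool, Q k (wt t) / ((n.choose k : ℝ) * m.choose (wt t)) *
          (K * (v d n p₁ k * v d m p₂ (wt t))))]
  simp only [objective, dotProduct, Matrix.mulVec, Finset.mul_sum]
  refine Finset.sum_congr rfl fun k _ => ?_
  rw [← Finset.mul_sum, sum_comp_wt (fun l => Q k l / ((n.choose k : ℝ) * m.choose l) *
          (K * (v d n p₁ k * v d m p₂ l))), Finset.mul_sum]
  refine Finset.sum_congr rfl fun l _ => ?_
  have := h2 n k
  have := h2 m l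
  field_simp

theorem objective_nonneg_of_isDecomposable {d : ℕ} (hd : 2 ≤ d) {n m : ℕ} {p₁ p₂ : ℝ}
    (h : IsDecomposable (mixedPower d n m p₁ p₂)) {Q : Matrix (Fin (n + 1)) (Fin (m + 1)) ℝ}
    (hQ : Q ∈ feasible d n m) : 0 ≤ objective d n m p₁ p₂ Q := by
  obtain ⟨A, B, hA, hB, hAB⟩ := (isDecomposable_iff_choi _).1 h
  have h1 := add_nonneg (trace_mul_nonneg (posSemidef_witness hd hQ.1) hA)
    (trace_mul_nonneg (posSemidef_partialTranspose_witness hd hQ.2.1) hB)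
  rw [trace_partialTranspose_mul, ← Matrix.trace_add, ← Matrix.mul_add, ← hAB,
    trace_witness_mul_choi hd, Complex.zero_le_real] at h1
  have := wernerRank_pos hd false
  exact (mul_nonneg_iff_of_pos_left (by positivity)).1 h1

end WernerLP

end

theorem mainTheorem5 (d n m : ℕ) (hd : 2 ≤ d) (p₁ p₂ : ℝ)
    (hp₁ : p₁ ∈ Set.Icc (0 : ℝ) 1) (hp₂ : p₂ ∈ Set.Icc (0 : ℝ) 1) :
    ∃ val : ℝ,
      IsLeast (WernerLP.objective d n m p₁ p₂ '' WernerLP.feasible d n m) val ∧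
      (WernerLP.IsDecomposable (WernerLP.mixedPower d n m p₁ p₂) ↔ 0 ≤ val) := by
  obtain ⟨val, hval⟩ := WernerLP.exists_isLeast_objective hd n m p₁ p₂
  refine ⟨val, hval, fun h => ?_, fun h => ?_⟩
  · obtain ⟨Q, hQ, rfl⟩ := hval.1
    exact WernerLP.objective_nonneg_of_isDecomposable hd h hQ
  · obtain ⟨A, B, hA, hB, hAB⟩ := WernerLP.exists_dual_solution hd fun Q hQ =>
      h.trans (hval.2 (Set.mem_image_of_mem _ hQ))
    exact WernerLP.isDecomposable_of_dual_solution hd hA hB hAB
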